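/- Let $n\ge 0$, let $R=\mathbb{C}[x_1,\dots,x_n]$ with $S_n$ permuting the variables, and let $\ell(w)$ be the Bruhat (Coxeter) length of $w\in S_n$ with respect to the simple reflections $(j\ j{+}1)$. For $w\in S_n$ put $$\Delta_w=\prod_{i<j,\ w(i)>w(j)}(x_i-x_j).$$ Let $R_w$ be the $R$-bimodule (that is, $R\otimes_{\mathbb C}R$-module) with underlying space $R$ and action $(f\otimes g)\cdot h=g(x_{w(1)},\dots,x_{w(n)})\,f\,h$, and let $$F_w\colon R\otimes_{R^{S_n}}R\to R_w,\qquad f\otimes g\mapsto g(x_{w(1)},\dots,x_{w(n)})\,f,$$ which is a homomorphism of $R$-bimodules. Write $R_w\cdot\Delta_w\subset R_w$ for the sub-bimodule of right multiples of $\Delta_w$, i.e. $\{\Delta_w(x_{w(1)},\dots,x_{w(n)})\,h : h\in R\}$ (as a subset of $R$ it is the ideal generated by $\Delta_{w^{-1}}$), and $\Delta_w\cdot R_w$ for the sub-bimodule of left multiples. Then the $R$-bimodule $R\otimes_{R^{S_n}}R$ admits a filtration by sub-bimodules $$0=\Gamma_{\binom n2+1}\subset\Gamma_{\binom n2}\subset\cdots\subset\Gamma_1\subset\Gamma_0=R\otimes_{R^{S_n}}R$$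 such that for every $0\le j\le\binom n2$ the maps $F_w$ with $\ell(w)=j$ induce an isomorphism of $R$-bimodules $$\bigoplus_{\ell(w)=j}F_w\colon\ \Gamma_j/\Gamma_{j+1}\xrightarrow{\ \sim\ }\bigoplus_{\ell(w)=j}R_w\cdot\Delta_w .$$ In particular $\Gamma_j/\Gamma_{j+1}$ is also isomorphic, as an $R$-bimodule, to $\bigoplus_{\ell(w)=j}\Delta_w\cdot R_w$. -/

import Mathlib

open scoped TensorProduct DirectSum

noncomputable section

namespace GammaFiltration

/-- `R = ℂ[x₁, …, xₙ]`. -/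
abbrev R (n : ℕ) : Type := MvPolynomial (Fin n) ℂ

/-- `R^{Sₙ}`, the subalgebra of symmetric polynomials. -/
abbrev RSym (n : ℕ) : Subalgebra ℂ (R n) := MvPolynomial.symmetricSubalgebra (Fin n) ℂ

/-- The enveloping algebra `R ⊗_ℂ R`. An `R`-bimodule (over `ℂ`) is a module over it: `f ⊗ g` acts
by `f` from the left and by `g` from the right. -/
def Env (n : ℕ) : Type := R n ⊗[ℂ] R n

instance instCommRingEnv (n : ℕ) : CommRing (Env n) :=
  inferInstanceAs (CommRing (R n ⊗[ℂ] R n))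

/-- The element `f ⊗ g` of `R ⊗_ℂ R`. -/
def Env.tmul {n : ℕ} (f g : R n) : Env n := f ⊗ₜ[ℂ] g

/-- `R ⊗_{R^{Sₙ}} R`. -/
def T (n : ℕ) : Type := R n ⊗[RSym n] R n

instance instCommRingT (n : ℕ) : CommRing (T n) :=
  inferInstanceAs (CommRing (R n ⊗[RSym n] R n))

/-- The element `f ⊗ g` of `R ⊗_{R^{Sₙ}} R`. -/
def T.tmul {n : ℕ} (f g : R n) : T n := f ⊗ₜ[RSym n] g

/-- The simple reflections `(j j+1)` of `Sₙ`. -/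
def IsSimpleReflection {n : ℕ} (s : Equiv.Perm (Fin n)) : Prop :=
  ∃ i j : Fin n, (i : ℕ) + 1 = (j : ℕ) ∧ s = Equiv.swap i j

/-- The Bruhat (Coxeter) length: the least length of a word in simple reflections with product
`w`. -/
def length {n : ℕ} (w : Equiv.Perm (Fin n)) : ℕ :=
  sInf {k | ∃ l : List (Equiv.Perm (Fin n)),
    (∀ s ∈ l, IsSimpleReflection s) ∧ l.prod = w ∧ l.length = k}

/-- The inversions `(i, j)`, `i < j`, `w i > w j`. -/
def inv {n : ℕ} (w : Equiv.Perm (Fin n)) : Finset (Fin n × Fin n) :=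
  Finset.univ.filter fun p => p.1 < p.2 ∧ w p.2 < w p.1

/-- `Δ_w = ∏_{(i,j) ∈ inv w} (x_i - x_j)`. -/
def Delta {n : ℕ} (w : Equiv.Perm (Fin n)) : R n :=
  ∏ p ∈ inv w, (MvPolynomial.X p.1 - MvPolynomial.X p.2)

/-- The algebra map `R ⊗_ℂ R → R ⊗_{R^{Sₙ}} R`, `f ⊗ g ↦ f ⊗ g`. -/
def envToT (n : ℕ) : Env n →+* T n :=
  (Algebra.TensorProduct.lift
    (Algebra.TensorProduct.includeLeft : R n →ₐ[ℂ] R n ⊗[RSym n] R n)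
    ((Algebra.TensorProduct.includeRight :
      R n →ₐ[RSym n] R n ⊗[RSym n] R n).restrictScalars ℂ)
    (fun _ _ => Commute.all _ _) : R n ⊗[ℂ] R n →ₐ[ℂ] R n ⊗[RSym n] R n).toRingHom

/-- The bimodule structure on `R ⊗_{R^{Sₙ}} R`: `(f ⊗ g) • (a ⊗ b) = f a ⊗ g b`. -/
instance instModuleT (n : ℕ) : Module (Env n) (T n) :=
  Module.compHom (T n) (envToT n)

/-- The algebra map `R ⊗_ℂ R → R`, `f ⊗ g ↦ f · g(x_{w(1)}, …, x_{w(n)})`. -/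
def envToR {n : ℕ} (w : Equiv.Perm (Fin n)) : Env n →+* R n :=
  (Algebra.TensorProduct.lift (AlgHom.id ℂ (R n)) (MvPolynomial.rename w)
    (fun _ _ => Commute.all _ _) : R n ⊗[ℂ] R n →ₐ[ℂ] R n).toRingHom

/-- The underlying additive group of the bimodule `R_w`, which is that of `R`. -/
def RTw {n : ℕ} (_w : Equiv.Perm (Fin n)) : Type := R n

instance instAddCommGroupRTw {n : ℕ} (w : Equiv.Perm (Fin n)) : AddCommGroup (RTw w) :=
  inferInstanceAs (AddCommGroup (R n))

/-- The twisted bimodule structure of `R_w`: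
`(f ⊗ g) • h = g(x_{w(1)}, …, x_{w(n)}) f h`. -/
instance instModuleRTw {n : ℕ} (w : Equiv.Perm (Fin n)) : Module (Env n) (RTw w) :=
  Module.compHom (R n) (envToR w)

/-- `g ↦ g(x_{w(1)}, …, x_{w(n)})` as a map of `R^{Sₙ}`-algebras. -/
def renameSym {n : ℕ} (w : Equiv.Perm (Fin n)) : R n →ₐ[RSym n] R n :=
  { (MvPolynomial.rename w : R n →ₐ[ℂ] R n).toRingHom with
    commutes' := fun r => r.2 w }

/-- `R ⊗_{R^{Sₙ}} R → R`, `f ⊗ g ↦ f · g(x_{w(1)}, …, x_{w(n)})`. -/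
def FAlg {n : ℕ} (w : Equiv.Perm (Fin n)) : T n →+* R n :=
  (Algebra.TensorProduct.lift (AlgHom.id (RSym n) (R n)) (renameSym w)
    (fun _ _ => Commute.all _ _) : R n ⊗[RSym n] R n →ₐ[RSym n] R n).toRingHom

theorem envToT_tmul {n : ℕ} (f g : R n) : envToT n (Env.tmul f g) = T.tmul f g := by
  change (f ⊗ₜ[RSym n] (1 : R n)) * ((1 : R n) ⊗ₜ[RSym n] g) = f ⊗ₜ[RSym n] g
  rw [Algebra.TensorProduct.tmul_mul_tmul, mul_one, one_mul]

theorem envToR_tmul {n : ℕ} (w : Equiv.Perm (Fin n)) (f g : R n) :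
    envToR w (Env.tmul f g) = f * MvPolynomial.rename w g :=
  rfl

theorem FAlg_tmul {n : ℕ} (w : Equiv.Perm (Fin n)) (f g : R n) :
    FAlg w (T.tmul f g) = f * MvPolynomial.rename w g :=
  rfl

theorem FAlg_envToT {n : ℕ} (w : Equiv.Perm (Fin n)) (a : Env n) :
    FAlg w (envToT n a) = envToR w a := by
  refine TensorProduct.induction_on (motive := fun a : R n ⊗[ℂ] R n =>
    FAlg w (envToT n a) = envToR w a) a ?_ ?_ ?_
  · exact (congrArg (FAlg w) (map_zero (envToT n))).trans
      ((map_zero (FAlg w)).trans (map_zero (envToR w)).symm)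
  · intro f g
    exact (congrArg (FAlg w) (envToT_tmul f g)).trans
      ((FAlg_tmul w f g).trans (envToR_tmul w f g).symm)
  · intro a b ha hb
    have h1 := map_add (envToT n) a b
    have h2 := map_add (envToR w) a b
    exact (congrArg (FAlg w) h1).trans ((map_add (FAlg w) _ _).trans
      ((congrArg₂ (· + ·) ha hb).trans h2.symm))

/-- The bimodule homomorphism `F_w : R ⊗_{R^{Sₙ}} R → R_w`,
`f ⊗ g ↦ g(x_{w(1)}, …, x_{w(n)}) f`. -/
def F {n : ℕ} (w : Equiv.Perm (Fin n)) : T n →ₗ[Env n] RTw w where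
  toFun := fun t => (FAlg w t : R n)
  map_add' := fun s t => map_add (FAlg w) s t
  map_smul' := fun a t => by
    change FAlg w (envToT n a * t) = envToR w a * FAlg w t
    rw [map_mul, FAlg_envToT]

/-- The sub-bimodule `f · R_w`: the multiples of `f`, acting from the left. -/
def leftMul {n : ℕ} (w : Equiv.Perm (Fin n)) (f : R n) : Submodule (Env n) (RTw w) :=
  LinearMap.range (LinearMap.lsmul (Env n) (RTw w) (Env.tmul f 1))

/-- The sub-bimodule `R_w · g`: the multiples of `g`, acting from the right. -/
def rightMul {n : ℕ} (w : Equiv.Perm (Fin n)) (g : R n) : Submodule (Env n) (RTw w) :=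
  LinearMap.range (LinearMap.lsmul (Env n) (RTw w) (Env.tmul 1 g))

/-- The successive quotient `A / B` of sub-bimodules `B ⊆ A` of `R ⊗_{R^{Sₙ}} R`. -/
abbrev Gr {n : ℕ} (A B : Submodule (Env n) (T n)) : Type :=
  A ⧸ B.submoduleOf A

end GammaFiltration

end

/-! Take `Γ_j` to be the common kernel of the maps `F_v` with `ℓ(v) < j`. Three facts make it
work.

* `F_w - F_{(a b) w}` is divisible by `x_a - x_b`. For an inversion `(i, j)` of `w` the strong
  exchange property gives `ℓ(w (i j)) < ℓ(w)`, so on `Γ_{ℓ(w)}` the values of `F_w` are divisible by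
  `x_{w(i)} - x_{w(j)}`; these factors are pairwise coprime and their product is `w(Δ_w)`.
* The divisor `w(Δ_w)` is attained by an element which `F_v` kills for all other `v` with
  `ℓ(v) ≤ ℓ(w)`. For `w = w₀` one takes `∏_{i<j} (x_{w₀(i)} ⊗ 1 - 1 ⊗ x_j)`, which is supported
  on the graph of `w₀`, and from `w s` with `s = (i i+1)` and `w(i) < w(i+1)` one descends to `w`
  by a divided difference in the right tensor factor. Hence the `F_w` with `ℓ(w) = j` map `Γ_j` onto
  `⨁ R_w · Δ_w`.
* The `F_w` are jointly injective. Let `∂` be the antisymmetrization divided by the Vandermonde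
  product, and write `∏_{i<j} (x_i ⊗ 1 - 1 ⊗ x_j) = ∑ a_l ⊗ b_l`. Only `F_1` does not kill this
  element, so `h = ∑ ∂(b_l h) a_l` for every `h`, and every `f ⊗ g` equals
  `∑ f ∂(b_l g) ⊗ a_l`. The Vandermonde product times `f ∂(b g)` is
  `∑_w sgn(w) w(b) F_w(f ⊗ g)`, so an element killed by all `F_w` vanishes.
-/

namespace GammaFiltration

open MvPolynomial Equiv

noncomputable section

section Words

variable {n : ℕ} {w : Perm (Fin n)} {i j : Fin n}

theorem swap_lt_swap_of_covBy {α : Type*} [LinearOrder α] {a b x y : α} (hab : a ⋖ b)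
    (hxy : x < y) (hne : (x, y) ≠ (a, b)) : swap a b x < swap a b y := by
  have hlt := hab.lt
  have hcov (c : α) : c ≤ a ∨ b ≤ c := (le_or_gt c a).imp_right hab.ge_of_gt
  rw [swap_apply_def, swap_apply_def]
  grind [hcov x, hcov y]

theorem isSimpleReflection_swap (hij : i ⋖ j) : IsSimpleReflection (swap i j) :=
  ⟨i, j, Nat.covBy_iff_add_one_eq.1 (Fin.covBy_iff.1 hij), rfl⟩

theorem IsSimpleReflection.exists_covBy {s : Perm (Fin n)} (hs : IsSimpleReflection s) :
    ∃ i j : Fin n, i ⋖ j ∧ s = swap i j := by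
  obtain ⟨i, j, hij, rfl⟩ := hs
  exact ⟨i, j, Fin.covBy_iff.2 (Nat.covBy_iff_add_one_eq.2 hij), rfl⟩

theorem mem_inv {p : Fin n × Fin n} : p ∈ inv w ↔ p.1 < p.2 ∧ w p.2 < w p.1 := by
  simp only [inv, Finset.mem_filter_univ]

theorem inv_one : inv (1 : Perm (Fin n)) = ∅ :=
  Finset.eq_empty_of_forall_notMem fun _ hp => (mem_inv.1 hp).1.not_gt (mem_inv.1 hp).2

theorem notMem_map_inv_of_covBy (hij : i ⋖ j) :
    (i, j) ∉ (inv w).map ((swap i j).prodCongr (swap i j)).toEmbedding := by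
  simpa [Finset.mem_map_equiv, mem_inv] using fun h : j < i => absurd h hij.lt.not_gt

theorem inv_mul_swap (hij : i ⋖ j) (hw : w i < w j) :
    inv (w * swap i j) =
      insert (i, j) ((inv w).map ((swap i j).prodCongr (swap i j)).toEmbedding) := by
  ext ⟨a, b⟩
  simp only [Finset.mem_insert, Finset.mem_map_equiv, mem_inv, prodCongr_symm, prodCongr_apply,
    Prod.map_apply, symm_swap, Perm.coe_mul, Function.comp_apply]
  by_cases hab : (a, b) = (i, j)
  · obtain ⟨rfl, rfl⟩ := Prod.mk.inj hab
    simpa using ⟨hij.lt, hw⟩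
  by_cases hba : (a, b) = (j, i)
  · obtain ⟨rfl, rfl⟩ := Prod.mk.inj hba
    simp [hab, hij.lt.not_gt, hw.not_gt]
  have hlt : swap i j a < swap i j b ↔ a < b := by
    refine ⟨fun h => ?_, fun h => swap_lt_swap_of_covBy hij h hab⟩
    have hne : (swap i j a, swap i j b) ≠ (i, j) := fun h => hba <| by
      simpa [swap_apply_eq_iff] using h
    simpa using swap_lt_swap_of_covBy hij h hne
  simp [hab, hlt]

theorem card_inv_mul_swap (hij : i ⋖ j) (hw : w i < w j) :
    (inv (w * swap i j)).card = (inv w).card + 1 := by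
  rw [inv_mul_swap hij hw, Finset.card_insert_of_notMem (notMem_map_inv_of_covBy hij),
    Finset.card_map]

theorem card_inv_le_choose_two (w : Perm (Fin n)) : (inv w).card ≤ n.choose 2 := by
  have hsub : inv w ⊆ Finset.univ.filter fun p => p.1 < p.2 :=
    Finset.monotone_filter_right _ fun _ _ hp => hp.1
  simpa [Fintype.card_product_filter_lt] using Finset.card_le_card hsub

theorem exists_covBy_apply_lt_of_ne_one (hw : w ≠ 1) : ∃ i j, i ⋖ j ∧ w j < w i := by
  by_contra! h
  exact hw ((Perm.monotone_iff w).1 ((monotone_iff_forall_covBy w).2 h))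

theorem ascent_induction {P : Perm (Fin n) → Prop} (one : P 1)
    (mul_swap : ∀ w i j, i ⋖ j → w i < w j → P w → P (w * swap i j)) (w : Perm (Fin n)) :
    P w := by
  induction hk : (inv w).card using Nat.strong_induction_on generalizing w with
  | _ k ih =>
    subst hk
    obtain rfl | hw := eq_or_ne w 1
    · exact one
    obtain ⟨i, j, hij, hlt⟩ := exists_covBy_apply_lt_of_ne_one hw
    have hasc : (w * swap i j) i < (w * swap i j) j := by simpa using hlt
    have hw' : w * swap i j * swap i j = w := by simp [mul_assoc]
    have hcard := card_inv_mul_swap hij hasc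
    rw [hw'] at hcard
    simpa only [hw'] using mul_swap _ i j hij hasc (ih _ (by omega) _ rfl)

theorem descent_induction {P : Perm (Fin n) → Prop} (rev : P Fin.revPerm)
    (of_mul_swap : ∀ w i j, i ⋖ j → w i < w j → P (w * swap i j) → P w) (w : Perm (Fin n)) :
    P w := by
  have hrev (u : Perm (Fin n)) : P (Fin.revPerm * u) := by
    induction u using ascent_induction with
    | one => exact rev
    | mul_swap u i j hij hlt ih =>
      refine of_mul_swap _ i j hij (by simpa using hlt) ?_
      simpa [mul_assoc] using ih
  obtain ⟨u, rfl⟩ := mul_left_surjective Fin.revPerm w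
  exact hrev u

theorem exists_word_length_eq_card_inv (w : Perm (Fin n)) :
    ∃ l : List (Perm (Fin n)), (∀ s ∈ l, IsSimpleReflection s) ∧ l.prod = w ∧
      l.length = (inv w).card := by
  induction w using ascent_induction with
  | one => exact ⟨[], by simp [inv_one]⟩
  | mul_swap w i j hij hlt ih =>
    obtain ⟨l, hl, rfl, hcard⟩ := ih
    exact ⟨l ++ [swap i j], by simpa [or_imp, forall_and] using ⟨hl, isSimpleReflection_swap hij⟩,
      by simp, by simp [hcard, card_inv_mul_swap hij hlt]⟩

theorem strong_exchange (l : List (Perm (Fin n))) (hl : ∀ s ∈ l, IsSimpleReflection s)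
    {p : Fin n × Fin n} (hp : p ∈ inv l.prod) :
    ∃ l' : List (Perm (Fin n)), (∀ s ∈ l', IsSimpleReflection s) ∧
      l'.prod = l.prod * swap p.1 p.2 ∧ l'.length < l.length := by
  induction l using List.reverseRecOn generalizing p with
  | nil => simp [inv_one] at hp
  | append_singleton l s ih =>
    simp only [List.forall_mem_append, List.forall_mem_singleton, List.prod_append,
      List.prod_singleton] at hl hp ⊢
    obtain ⟨i, j, hij, rfl⟩ := hl.2.exists_covBy
    by_cases h : p = (i, j)
    · exact ⟨l, hl.1, by simp [h, mul_assoc], by simp⟩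
    rw [mem_inv] at hp
    obtain ⟨l', hl', hprod, hlen⟩ := ih hl.1 (p := (swap i j p.1, swap i j p.2))
      (mem_inv.2 ⟨swap_lt_swap_of_covBy hij hp.1 h, hp.2⟩)
    refine ⟨l' ++ [swap i j], ?_, ?_, by simpa using hlen⟩
    · simpa only [List.forall_mem_append, List.forall_mem_singleton] using ⟨hl', hl.2⟩
    · simp [hprod, swap_apply_apply, mul_assoc]

theorem length_prod_le (l : List (Perm (Fin n))) (hl : ∀ s ∈ l, IsSimpleReflection s) :
    length l.prod ≤ l.length :=
  Nat.sInf_le ⟨l, hl, rfl, rfl⟩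

theorem exists_reduced_word (w : Perm (Fin n)) :
    ∃ l : List (Perm (Fin n)), (∀ s ∈ l, IsSimpleReflection s) ∧ l.prod = w ∧
      l.length = length w :=
  Nat.sInf_mem (s := {k | ∃ l : List (Perm (Fin n)),
    (∀ s ∈ l, IsSimpleReflection s) ∧ l.prod = w ∧ l.length = k})
    ⟨_, exists_word_length_eq_card_inv w⟩

theorem length_le_choose_two (w : Perm (Fin n)) : length w ≤ n.choose 2 := by
  obtain ⟨l, hl, rfl, hcard⟩ := exists_word_length_eq_card_inv w
  exact (length_prod_le l hl).trans (hcard.trans_le (card_inv_le_choose_two _))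

theorem length_mul_swap_lt {p : Fin n × Fin n} (hp : p ∈ inv w) :
    length (w * swap p.1 p.2) < length w := by
  obtain ⟨l, hl, rfl, hlen⟩ := exists_reduced_word w
  obtain ⟨l', hl', hprod, hlt⟩ := strong_exchange l hl hp
  rw [← hlen, ← hprod]
  exact (length_prod_le l' hl').trans_lt hlt

theorem length_mul_swap_le (w : Perm (Fin n)) (hij : i ⋖ j) :
    length (w * swap i j) ≤ length w + 1 := by
  obtain ⟨l, hl, rfl, hlen⟩ := exists_reduced_word w
  have hword : ∀ s ∈ l ++ [swap i j], IsSimpleReflection s := by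
    simpa only [List.forall_mem_append, List.forall_mem_singleton] using
      ⟨hl, isSimpleReflection_swap hij⟩
  simpa [hlen] using length_prod_le _ hword

theorem eq_one_of_forall_apply_le {α : Type*} [PartialOrder α] [WellFoundedLT α] {σ : Perm α}
    (h : ∀ a, σ a ≤ a) : σ = 1 := by
  ext a
  induction a using WellFoundedLT.induction with
  | ind a ih =>
    by_contra hne
    exact hne (σ.injective (ih _ ((h a).lt_of_ne hne)))

end Words

section Differences

variable {σ A : Type*} [CommRing A] {i j k l : σ}

theorem X_sub_X_ne_zero [Nontrivial A] (hij : i ≠ j) : (X i - X j : MvPolynomial σ A) ≠ 0 :=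
  sub_ne_zero.2 ((X_injective (R := A)).ne hij)

theorem irreducible_X_sub_X [IsDomain A] (hij : i ≠ j) :
    Irreducible (X i - X j : MvPolynomial σ A) := by
  classical
  have hcoeff : (Finsupp.single i 1 - Finsupp.single j 1 : σ →₀ A) i = 1 := by simp [hij]
  have hirr := irreducible_sumSMulX (Finsupp.single i 1 - Finsupp.single j 1 : σ →₀ A)
    ⟨i, by simp [hcoeff]⟩ fun r hr => isUnit_of_dvd_one (hcoeff ▸ hr i)
  simpa [sumSMulX] using hirr

theorem not_X_sub_X_dvd [Nontrivial A] (hkl : k ≠ l) (hki : k ≠ i) (hkj : k ≠ j) :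
    ¬ (X i - X j : MvPolynomial σ A) ∣ X k - X l := by
  classical
  rintro ⟨c, hc⟩
  have heval := congrArg (eval (Pi.single k (1 : A))) hc
  simp [hki.symm, hkj.symm, hkl.symm] at heval

theorem isRelPrime_X_sub_X [IsDomain A] (hij : i ≠ j) (hkl : k ≠ l) (hne : s(i, j) ≠ s(k, l)) :
    IsRelPrime (X i - X j : MvPolynomial σ A) (X k - X l) := by
  rw [(irreducible_X_sub_X hij).isRelPrime_iff_not_dvd]
  by_cases hk : k ≠ i ∧ k ≠ j
  · exact not_X_sub_X_dvd hkl hk.1 hk.2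
  · have hl : l ≠ i ∧ l ≠ j := by grind
    rw [← dvd_neg, neg_sub]
    exact not_X_sub_X_dvd hkl.symm hl.1 hl.2

theorem prod_X_sub_X_dvd [IsDomain A] [UniqueFactorizationMonoid A] {ι : Type*} {s : Finset ι}
    {a b : ι → σ} (hne : ∀ p ∈ s, a p ≠ b p) (hinj : Set.InjOn (fun p => s(a p, b p)) s)
    {f : MvPolynomial σ A} (hf : ∀ p ∈ s, X (a p) - X (b p) ∣ f) :
    ∏ p ∈ s, (X (a p) - X (b p)) ∣ f :=
  Finset.prod_dvd_of_isRelPrime (fun p hp q hq hpq =>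
    isRelPrime_X_sub_X (hne p hp) (hne q hq) (hinj.ne hp hq hpq)) hf

theorem dvd_aeval_sub_aeval {B : Type*} [CommRing B] [Algebra A B] {x y : σ → B} {b : B}
    (h : ∀ k, b ∣ x k - y k) (f : MvPolynomial σ A) : b ∣ aeval x f - aeval y f := by
  have heq : (Ideal.Quotient.mkₐ A (Ideal.span {b})).comp (aeval x) =
      (Ideal.Quotient.mkₐ A (Ideal.span {b})).comp (aeval y) :=
    algHom_ext fun k => by
      simpa [Ideal.Quotient.eq, Ideal.mem_span_singleton] using h k
  rw [← Ideal.mem_span_singleton, ← Ideal.Quotient.eq]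
  exact DFunLike.congr_fun heq f

theorem X_sub_X_dvd_sub_rename_swap [DecidableEq σ] (i j : σ) (f : MvPolynomial σ A) :
    X i - X j ∣ f - rename (swap i j) f := by
  have hX (k : σ) : (X i - X j : MvPolynomial σ A) ∣ X k - X (swap i j k) := by
    rw [swap_apply_def]
    split_ifs with hi hj
    · rw [hi]
    · rw [hj, dvd_sub_comm]
    · simp
  simpa only [rename_eq_aeval, aeval_X_left_apply, Function.comp_def] using dvd_aeval_sub_aeval hX f

theorem X_sub_X_dvd_of_rename_swap_eq_neg [DecidableEq σ] (h2 : IsUnit (2 : A))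
    {f : MvPolynomial σ A} (hf : rename (swap i j) f = -f) : X i - X j ∣ f := by
  have hdvd := X_sub_X_dvd_sub_rename_swap i j f
  rw [hf, sub_neg_eq_add, ← two_mul] at hdvd
  have h2' : IsUnit (2 : MvPolynomial σ A) := by
    simpa only [map_ofNat] using h2.map (C (σ := σ))
  exact h2'.dvd_mul_left.1 hdvd

end Differences

section LinearAlgebra

variable {S : Type*} [CommSemiring S]

/-- The exact quotient `m ↦ L m / a` of a linear map by a left regular element which divides all
its values. -/
def divLeftRegular {M A : Type*} [AddCommMonoid M] [Module S M] [CommSemiring A] [Algebra S A]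
    {a : A} (ha : IsLeftRegular a) (L : M →ₗ[S] A) (hL : ∀ m, a ∣ L m) : M →ₗ[S] A where
  toFun m := (hL m).choose
  map_add' x y := ha <| by
    beta_reduce
    rw [mul_add, ← (hL x).choose_spec, ← (hL y).choose_spec, ← (hL (x + y)).choose_spec, map_add]
  map_smul' r x := ha <| by
    beta_reduce
    rw [RingHom.id_apply, mul_smul_comm, ← (hL x).choose_spec, ← (hL (r • x)).choose_spec,
      map_smul]

theorem mul_divLeftRegular {M A : Type*} [AddCommMonoid M] [Module S M] [CommSemiring A]
    [Algebra S A] {a : A} (ha : IsLeftRegular a) (L : M →ₗ[S] A) (hL : ∀ m, a ∣ L m) (m : M) :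
    a * divLeftRegular ha L hL m = L m :=
  (hL m).choose_spec.symm

theorem sum_rid_lTensor_tmul {M N ι : Type*} [AddCommMonoid M] [Module S M] [AddCommMonoid N]
    [Module S N] [Fintype ι] {φ : ι → M →ₗ[S] S} {a : ι → M}
    (hφ : ∀ m, ∑ l, φ l m • a l = m) (t : N ⊗[S] M) :
    ∑ l, TensorProduct.rid S N ((φ l).lTensor N t) ⊗ₜ[S] a l = t := by
  induction t with
  | zero => simp
  | tmul x m =>
    simp only [LinearMap.lTensor_tmul, TensorProduct.rid_tmul, TensorProduct.smul_tmul,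
      ← TensorProduct.tmul_sum, hφ]
  | add s t hs ht =>
    simp only [map_add, TensorProduct.add_tmul, Finset.sum_add_distrib, hs, ht]

end LinearAlgebra

section Delta

variable {n : ℕ} {w : Perm (Fin n)} {i j : Fin n}

theorem rename_Delta (w : Perm (Fin n)) :
    rename w (Delta w) = ∏ p ∈ inv w, (X (w p.1) - X (w p.2) : R n) := by
  simp only [Delta, map_prod, map_sub, rename_X]

theorem Delta_ne_zero (w : Perm (Fin n)) : Delta w ≠ 0 :=
  Finset.prod_ne_zero_iff.2 fun _ hp => X_sub_X_ne_zero (mem_inv.1 hp).1.ne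

theorem rename_Delta_ne_zero (u w : Perm (Fin n)) : rename u (Delta w) ≠ 0 :=
  (map_ne_zero_iff _ (rename_injective u u.injective)).2 (Delta_ne_zero w)

theorem rename_Delta_mul_swap (hij : i ⋖ j) (hw : w i < w j) :
    rename (w * swap i j) (Delta (w * swap i j)) =
      (X (w j) - X (w i)) * rename w (Delta w) := by
  rw [rename_Delta, rename_Delta, inv_mul_swap hij hw,
    Finset.prod_insert (notMem_map_inv_of_covBy hij), Finset.prod_map]
  simp

theorem Delta_revPerm (n : ℕ) :
    Delta (Fin.revPerm : Perm (Fin n)) =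
      ∏ p : Fin n × Fin n with p.1 < p.2, (X p.1 - X p.2) :=
  Finset.prod_congr (by ext; simp [mem_inv]) fun _ _ => rfl

theorem rename_Delta_revPerm (w : Perm (Fin n)) :
    rename w (Delta (Fin.revPerm : Perm (Fin n))) =
      ((Perm.sign w : ℤ) : R n) * Delta Fin.revPerm := by
  have hnested (f : Fin n → Fin n → R n) :
      ∏ p : Fin n × Fin n with p.1 < p.2, f p.1 p.2 = ∏ i, ∏ j ∈ Finset.Ioi i, f i j := by
    simp only [Finset.prod_filter, Fintype.prod_prod_type, ← Finset.filter_lt_eq_Ioi]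
  simp only [Delta_revPerm, map_prod, map_sub, rename_X]
  rw [hnested fun i j => X (w i) - X (w j), hnested fun i j => X i - X j]
  exact w.prod_Ioi_comp_eq_sign_mul_prod (f := fun i j => X i - X j) fun _ _ =>
    (neg_sub _ _).symm

theorem prod_inv_X_sub_X_dvd (u : Perm (Fin n)) {f : R n}
    (hf : ∀ p ∈ inv w, X (u p.1) - X (u p.2) ∣ f) :
    ∏ p ∈ inv w, (X (u p.1) - X (u p.2)) ∣ f := by
  refine prod_X_sub_X_dvd (fun p hp => u.injective.ne (mem_inv.1 hp).1.ne) ?_ hf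
  intro p hp q hq h
  have hpq : s(p.1, p.2) = s(q.1, q.2) := Sym2.map.injective u.injective h
  have hp' := (mem_inv.1 hp).1
  have hq' := (mem_inv.1 hq).1
  grind [Sym2.eq_iff]

end Delta

section Evaluation

variable {n : ℕ} {w : Perm (Fin n)} {i j : Fin n} {t : T n}

theorem T.induction_on {P : T n → Prop} (t : T n) (tmul : ∀ f g, P (T.tmul f g))
    (add : ∀ s t, P s → P t → P (s + t)) : P t := by
  refine TensorProduct.induction_on (motive := P) t ?_ tmul add
  have hzero : T.tmul (0 : R n) 0 = 0 := TensorProduct.zero_tmul _ _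
  exact hzero ▸ tmul 0 0

theorem X_sub_X_dvd_FAlg_sub (w : Perm (Fin n)) (a b : Fin n) (t : T n) :
    X a - X b ∣ FAlg w t - FAlg (swap a b * w) t := by
  induction t using T.induction_on with
  | tmul f g =>
    rw [FAlg_tmul, FAlg_tmul, Perm.coe_mul, ← rename_rename, ← mul_sub]
    exact (X_sub_X_dvd_sub_rename_swap a b _).mul_left f
  | add s t hs ht =>
    rw [map_add, map_add, add_sub_add_comm]
    exact dvd_add hs ht

theorem rename_Delta_dvd_FAlg (ht : ∀ v, length v < length w → FAlg v t = 0) :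
    rename w (Delta w) ∣ FAlg w t := by
  rw [rename_Delta]
  refine prod_inv_X_sub_X_dvd w fun p hp => ?_
  have hlt : length (swap (w p.1) (w p.2) * w) < length w := by
    rw [← mul_swap_eq_swap_mul]
    exact length_mul_swap_lt hp
  simpa only [ht _ hlt, sub_zero] using X_sub_X_dvd_FAlg_sub w (w p.1) (w p.2) t

/-- The divided difference operator `f ↦ (f - s f) / (x_i - x_j)`, `s = (i j)`. -/
def dividedDifference (hij : i ≠ j) : R n →ₗ[RSym n] R n :=
  divLeftRegular (IsLeftCancelMulZero.mul_left_cancel_of_ne_zero (X_sub_X_ne_zero hij))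
    (LinearMap.id - (renameSym (swap i j)).toLinearMap) (X_sub_X_dvd_sub_rename_swap i j)

theorem X_sub_X_mul_dividedDifference (hij : i ≠ j) (f : R n) :
    (X i - X j) * dividedDifference hij f = f - rename (swap i j) f :=
  mul_divLeftRegular _ _ _ f

/-- The endomorphism `1 ⊗ φ` of `R ⊗_{R^{Sₙ}} R`. -/
def T.mapRight (φ : R n →ₗ[RSym n] R n) : T n →+ T n :=
  (φ.lTensor (R n)).toAddMonoidHom

theorem T.mapRight_tmul (φ : R n →ₗ[RSym n] R n) (f g : R n) :
    T.mapRight φ (T.tmul f g) = T.tmul f (φ g) :=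
  LinearMap.lTensor_tmul _ _ _ _

theorem X_sub_X_mul_FAlg_mapRight (hij : i ≠ j) (v : Perm (Fin n)) (t : T n) :
    (X (v i) - X (v j)) * FAlg v (T.mapRight (dividedDifference hij) t) =
      FAlg v t - FAlg (v * swap i j) t := by
  induction t using T.induction_on with
  | tmul f g =>
    have hdiv := congrArg (rename v) (X_sub_X_mul_dividedDifference hij g)
    rw [map_mul, map_sub, map_sub, rename_X, rename_X, rename_rename] at hdiv
    rw [T.mapRight_tmul, FAlg_tmul, FAlg_tmul, FAlg_tmul, mul_left_comm, hdiv, mul_sub,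
      Perm.coe_mul]
  | add s t hs ht =>
    simp only [map_add, mul_add, hs, ht]
    ring

end Evaluation

section TriangularFamily

variable {n : ℕ} {u v w : Perm (Fin n)} {i j : Fin n} {t : T n}

/-- The element `∏_{i<j} (x_{u(i)} ⊗ 1 - 1 ⊗ x_j)`. It is supported on the graph of `u`:
every `F_v` with `v ≠ u` kills it. -/
def graphElement (u : Perm (Fin n)) : T n :=
  ∏ p : Fin n × Fin n with p.1 < p.2, (T.tmul (X (u p.1)) 1 - T.tmul 1 (X p.2))

theorem FAlg_graphElement (v u : Perm (Fin n)) :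
    FAlg v (graphElement u) =
      ∏ p : Fin n × Fin n with p.1 < p.2, (X (u p.1) - X (v p.2)) := by
  simp only [graphElement, map_prod, map_sub, FAlg_tmul, rename_X, map_one, mul_one, one_mul]

theorem FAlg_graphElement_self (u : Perm (Fin n)) :
    FAlg u (graphElement u) = rename u (Delta Fin.revPerm) := by
  simp only [FAlg_graphElement, Delta_revPerm, map_prod, map_sub, rename_X]

theorem FAlg_graphElement_of_ne (hvu : v ≠ u) : FAlg v (graphElement u) = 0 := by
  obtain ⟨i, hi⟩ : ∃ i, i < (v⁻¹ * u) i := by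
    by_contra! h
    exact hvu (inv_mul_eq_one.1 (eq_one_of_forall_apply_le h))
  rw [FAlg_graphElement]
  exact Finset.prod_eq_zero (i := (i, (v⁻¹ * u) i)) (by simpa using hi) (by simp)

/-- `t` can serve as the member of index `w` in a family for which the matrix of the values of the
maps `F_v` is triangular in the length order. Its diagonal entry `w(Δ_w)` is the best possible one,
by `rename_Delta_dvd_FAlg`. -/
structure IsTriangularAt (w : Perm (Fin n)) (t : T n) : Prop where
  self : FAlg w t = rename w (Delta w)
  eq_zero : ∀ v, v ≠ w → length v ≤ length w → FAlg v t = 0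

theorem isTriangularAt_graphElement :
    IsTriangularAt (Fin.revPerm : Perm (Fin n)) (graphElement Fin.revPerm) where
  self := FAlg_graphElement_self _
  eq_zero _ hv _ := FAlg_graphElement_of_ne hv

theorem IsTriangularAt.mapRight_dividedDifference (hij : i ⋖ j) (hw : w i < w j)
    (ht : IsTriangularAt (w * swap i j) t) :
    IsTriangularAt w (T.mapRight (dividedDifference hij.ne) t) := by
  have hss : w * swap i j * swap i j = w := by simp [mul_assoc]
  have hlt : length w < length (w * swap i j) := by
    have hinv : (i, j) ∈ inv (w * swap i j) := mem_inv.2 ⟨hij.lt, by simpa using hw⟩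
    simpa only [hss] using length_mul_swap_lt hinv
  have hne (v : Perm (Fin n)) : (X (v i) - X (v j) : R n) ≠ 0 :=
    X_sub_X_ne_zero (v.injective.ne hij.ne)
  refine ⟨mul_left_cancel₀ (hne w) ?_, fun v hv hvw => mul_left_cancel₀ (hne v) ?_⟩
  · have hself : w ≠ w * swap i j := fun h => hlt.ne (congrArg length h)
    rw [X_sub_X_mul_FAlg_mapRight, ht.self, ht.eq_zero w hself hlt.le,
      rename_Delta_mul_swap hij hw]
    ring
  · have hvs : v ≠ w * swap i j := fun h => (hvw.trans_lt hlt).ne (congrArg length h)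
    have hvs' : v * swap i j ≠ w * swap i j := fun h => hv (mul_right_cancel h)
    have hle : length (v * swap i j) ≤ length (w * swap i j) :=
      (length_mul_swap_le v hij).trans (Nat.succ_le_of_lt (hvw.trans_lt hlt))
    rw [X_sub_X_mul_FAlg_mapRight, ht.eq_zero v hvs (hvw.trans hlt.le),
      ht.eq_zero _ hvs' hle, sub_zero, mul_zero]

theorem exists_isTriangularAt (w : Perm (Fin n)) : ∃ t, IsTriangularAt w t := by
  induction w using descent_induction with
  | rev => exact ⟨_, isTriangularAt_graphElement⟩
  | of_mul_swap w i j hij hw ih =>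
    obtain ⟨t, ht⟩ := ih
    exact ⟨_, ht.mapRight_dividedDifference hij hw⟩

end TriangularFamily

section JointInjectivity

variable {n : ℕ}

/-- The operator `f ↦ ∑_w sgn(w) w(f)`. -/
def antisymmetrization (n : ℕ) : R n →ₗ[RSym n] R n :=
  ∑ w : Perm (Fin n), (Perm.sign w : ℤ) • (renameSym w).toLinearMap

theorem antisymmetrization_apply (f : R n) :
    antisymmetrization n f = ∑ w : Perm (Fin n), ((Perm.sign w : ℤ) : R n) * rename w f := by
  simp only [antisymmetrization, LinearMap.sum_apply, LinearMap.smul_apply, ← zsmul_eq_mul]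
  rfl

theorem rename_antisymmetrization (v : Perm (Fin n)) (f : R n) :
    rename v (antisymmetrization n f) = ((Perm.sign v : ℤ) : R n) * antisymmetrization n f := by
  simp only [antisymmetrization_apply, map_sum, map_mul, map_intCast, rename_rename,
    Finset.mul_sum, ← mul_assoc]
  refine Fintype.sum_equiv (Equiv.mulLeft v) _ _ fun w => ?_
  rw [coe_mulLeft, Perm.coe_mul, ← Int.cast_mul, ← Units.val_mul, Perm.sign_mul, ← mul_assoc,
    Int.units_mul_self, one_mul]

theorem Delta_revPerm_dvd_antisymmetrization (f : R n) :
    Delta Fin.revPerm ∣ antisymmetrization n f := by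
  refine prod_inv_X_sub_X_dvd 1 fun p hp => ?_
  refine X_sub_X_dvd_of_rename_swap_eq_neg (IsUnit.mk0 _ two_ne_zero) ?_
  rw [Perm.one_apply, Perm.one_apply, rename_antisymmetrization,
    Perm.sign_swap (mem_inv.1 hp).1.ne]
  simp

/-- The divided difference operator `∂_{w₀}` of the longest permutation, written as the
antisymmetrization divided by the Vandermonde product. -/
def topDividedDifference (n : ℕ) : R n →ₗ[RSym n] R n :=
  divLeftRegular (IsLeftCancelMulZero.mul_left_cancel_of_ne_zero (Delta_ne_zero Fin.revPerm))
    (antisymmetrization n) Delta_revPerm_dvd_antisymmetrization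

theorem Delta_revPerm_mul_topDividedDifference (f : R n) :
    Delta Fin.revPerm * topDividedDifference n f = antisymmetrization n f :=
  mul_divLeftRegular _ _ _ f

theorem rename_topDividedDifference (w : Perm (Fin n)) (f : R n) :
    rename w (topDividedDifference n f) = topDividedDifference n f := by
  have h := congrArg (rename w) (Delta_revPerm_mul_topDividedDifference f)
  rw [map_mul, rename_antisymmetrization, ← Delta_revPerm_mul_topDividedDifference, ← mul_assoc,
    ← rename_Delta_revPerm] at h
  exact mul_left_cancel₀ (rename_Delta_ne_zero w _) h

/-- `∂_{w₀}` as a map to `R^{Sₙ}`; it is the trace form which makes `R` a Frobenius algebra over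
`R^{Sₙ}`. -/
def frobeniusForm (n : ℕ) : R n →ₗ[RSym n] RSym n :=
  (topDividedDifference n).codRestrictOfInjective (Algebra.linearMap (RSym n) (R n))
    Subtype.val_injective fun f => ⟨⟨_, fun w => rename_topDividedDifference w f⟩, rfl⟩

theorem coe_frobeniusForm (f : R n) : (frobeniusForm n f : R n) = topDividedDifference n f :=
  LinearMap.codRestrictOfInjective_comp_apply _ (Algebra.linearMap (RSym n) (R n)) _ _ f

/-- The map `f ⊗ g ↦ f ∂_{w₀}(h g)`, which contracts the right tensor factor against `h`. -/
def T.contract (h : R n) : T n →+ R n :=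
  (TensorProduct.rid (RSym n) (R n) ∘ₗ
    (frobeniusForm n ∘ₗ LinearMap.mulLeft (RSym n) h).lTensor (R n)).toAddMonoidHom

theorem T.contract_tmul (h f g : R n) :
    T.contract h (T.tmul f g) = frobeniusForm n (h * g) * f :=
  rfl

theorem Delta_revPerm_mul_contract (h : R n) (t : T n) :
    Delta Fin.revPerm * T.contract h t =
      ∑ w : Perm (Fin n), ((Perm.sign w : ℤ) : R n) * (rename w h * FAlg w t) := by
  induction t using T.induction_on with
  | tmul f g =>
    rw [T.contract_tmul, coe_frobeniusForm, ← mul_assoc, Delta_revPerm_mul_topDividedDifference,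
      antisymmetrization_apply, Finset.sum_mul]
    refine Finset.sum_congr rfl fun w _ => ?_
    rw [FAlg_tmul, map_mul]
    ring
  | add s t hs ht => simp only [map_add, mul_add, hs, ht, Finset.sum_add_distrib]

theorem contract_graphElement_one (h : R n) : T.contract h (graphElement 1) = h := by
  refine mul_left_cancel₀ (Delta_ne_zero Fin.revPerm) ?_
  rw [Delta_revPerm_mul_contract, Fintype.sum_eq_single 1]
  · rw [FAlg_graphElement_self]
    simp [mul_comm]
  · intro w hw
    rw [FAlg_graphElement_of_ne hw, mul_zero, mul_zero]

theorem contract_eq_zero {t : T n} (ht : ∀ w, FAlg w t = 0) (h : R n) : T.contract h t = 0 := by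
  refine mul_left_cancel₀ (Delta_ne_zero Fin.revPerm) ?_
  simp only [Delta_revPerm_mul_contract, ht, mul_zero, Finset.sum_const_zero]

theorem exists_sum_contract_tmul (n : ℕ) :
    ∃ (k : ℕ) (a b : Fin k → R n), ∀ t, ∑ l, T.tmul (T.contract (b l) t) (a l) = t := by
  obtain ⟨k, a, b, hab⟩ :
      ∃ (k : ℕ) (a b : Fin k → R n), graphElement 1 = ∑ l, T.tmul (a l) (b l) :=
    TensorProduct.exists_sum_tmul_eq (R := RSym n) (M := R n) (N := R n) (graphElement 1)
  refine ⟨k, a, b, sum_rid_lTensor_tmul fun h => ?_⟩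
  have hdual := contract_graphElement_one h
  simp only [hab, map_sum, T.contract_tmul, mul_comm h] at hdual
  exact hdual

theorem eq_zero_of_forall_FAlg_eq_zero {t : T n} (ht : ∀ w, FAlg w t = 0) : t = 0 := by
  obtain ⟨k, a, b, hab⟩ := exists_sum_contract_tmul n
  rw [← hab t]
  refine Finset.sum_eq_zero fun l _ => ?_
  rw [contract_eq_zero ht]
  exact TensorProduct.zero_tmul _ _

end JointInjectivity

section Filtration

variable {n j : ℕ} {w : Perm (Fin n)}

theorem mem_rightMul {g : R n} {x : RTw w} : x ∈ rightMul w g ↔ rename w g ∣ (x : R n) := by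
  have hsmul (y : R n) :
      (LinearMap.lsmul (Env n) (RTw w) (Env.tmul 1 g) y : R n) = rename w g * y := by
    change envToR w (Env.tmul 1 g) * y = _
    rw [envToR_tmul, one_mul]
  exact exists_congr fun y => ⟨fun h => h.symm.trans (hsmul y), fun h => (hsmul y).trans h.symm⟩

theorem lsmul_injective {a : Env n} (ha : envToR w a ≠ 0) :
    Function.Injective (LinearMap.lsmul (Env n) (RTw w) a) := fun _ _ h =>
  mul_left_cancel₀ (M₀ := R n) ha h

/-- The isomorphism `R_w · Δ_w ≃ Δ_w · R_w` through `R_w`, of which both are copies because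
multiplication by `Δ_w` is injective on either side. -/
def rightMulEquivLeftMul (w : Perm (Fin n)) :
    rightMul w (Delta w) ≃ₗ[Env n] leftMul w (Delta w) :=
  have hright : envToR w (Env.tmul 1 (Delta w)) ≠ 0 := by
    rw [envToR_tmul, one_mul]
    exact rename_Delta_ne_zero w w
  have hleft : envToR w (Env.tmul (Delta w) 1) ≠ 0 := by
    rw [envToR_tmul, map_one, mul_one]
    exact Delta_ne_zero w
  (LinearEquiv.ofInjective _ (lsmul_injective hright)).symm.trans
    (LinearEquiv.ofInjective _ (lsmul_injective hleft))

/-- The filtration `Γ_j`: the common kernel of the maps `F_v` with `ℓ(v) < j`. -/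
def lengthFiltration (n j : ℕ) : Submodule (Env n) (T n) :=
  ⨅ (v : Perm (Fin n)) (_ : length v < j), LinearMap.ker (F v)

theorem mem_lengthFiltration {t : T n} :
    t ∈ lengthFiltration n j ↔ ∀ v, length v < j → FAlg v t = 0 := by
  simp only [lengthFiltration, Submodule.mem_iInf, LinearMap.mem_ker]
  rfl

theorem lengthFiltration_zero (n : ℕ) : lengthFiltration n 0 = ⊤ :=
  eq_top_iff.2 fun _ _ => mem_lengthFiltration.2 fun _ hv => absurd hv (Nat.not_lt_zero _)

theorem lengthFiltration_choose_two_add_one (n : ℕ) :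
    lengthFiltration n (n.choose 2 + 1) = ⊥ :=
  eq_bot_iff.2 fun _ ht => eq_zero_of_forall_FAlg_eq_zero fun w =>
    mem_lengthFiltration.1 ht w (Nat.lt_succ_of_le (length_le_choose_two w))

theorem lengthFiltration_antitone (n : ℕ) : Antitone (lengthFiltration n) := fun _ _ hjk _ ht =>
  mem_lengthFiltration.2 fun v hv => mem_lengthFiltration.1 ht v (hv.trans_le hjk)

theorem F_mem_rightMul {t : T n} (ht : t ∈ lengthFiltration n (length w)) :
    F w t ∈ rightMul w (Delta w) :=
  mem_rightMul.2 (rename_Delta_dvd_FAlg (mem_lengthFiltration.1 ht))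

/-- The map `⨁_{ℓ(w)=j} F_w` on `Γ_j`. -/
def layerMap (n j : ℕ) : lengthFiltration n j →ₗ[Env n]
    ⨁ w : {w : Perm (Fin n) // length w = j}, rightMul w.1 (Delta w.1) :=
  (DirectSum.linearEquivFunOnFintype (Env n) {w : Perm (Fin n) // length w = j}
    fun w => rightMul w.1 (Delta w.1)).symm.toLinearMap ∘ₗ
  LinearMap.pi fun w => (F w.1 ∘ₗ (lengthFiltration n j).subtype).codRestrict _
    fun m => F_mem_rightMul (w.2.symm ▸ m.2)

theorem layerMap_apply (m : lengthFiltration n j) (w : {w : Perm (Fin n) // length w = j}) :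
    (layerMap n j m w : RTw w.1) = F w.1 (m : T n) :=
  rfl

theorem ker_layerMap (n j : ℕ) :
    LinearMap.ker (layerMap n j) =
      (lengthFiltration n (j + 1)).submoduleOf (lengthFiltration n j) := by
  ext m
  rw [LinearMap.mem_ker, Submodule.submoduleOf, Submodule.mem_comap, mem_lengthFiltration]
  constructor
  · intro hm v hv
    obtain hlt | heq := Nat.lt_succ_iff_lt_or_eq.1 hv
    · exact mem_lengthFiltration.1 m.2 v hlt
    · have happly := layerMap_apply m ⟨v, heq⟩
      rw [hm] at happly
      exact happly.symm
  · intro hm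
    refine DFinsupp.ext fun w => Subtype.ext ?_
    exact (layerMap_apply m w).trans (hm w.1 (Nat.lt_succ_of_le w.2.le))

theorem exists_mem_lengthFiltration_FAlg_eq (h : {w : Perm (Fin n) // length w = j} → R n) :
    ∃ t ∈ lengthFiltration n j, ∀ w, FAlg w.1 t = rename w.1 (Delta w.1) * h w := by
  choose d hd using exists_isTriangularAt (n := n)
  have hF (v : Perm (Fin n)) : FAlg v (∑ w, T.tmul (h w) 1 * d w.1) =
      ∑ w, h w * FAlg v (d w.1) := by
    simp only [map_sum, map_mul, FAlg_tmul, map_one, mul_one]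
  refine ⟨∑ w, T.tmul (h w) 1 * d w.1, mem_lengthFiltration.2 fun v hv => ?_, fun v => ?_⟩
  · rw [hF]
    refine Finset.sum_eq_zero fun w _ => ?_
    have hlt : length v < length w.1 := hv.trans_eq w.2.symm
    rw [(hd w.1).eq_zero v (fun heq => hlt.ne (congrArg length heq)) hlt.le, mul_zero]
  · rw [hF, Fintype.sum_eq_single v, (hd v.1).self, mul_comm]
    intro w hw
    rw [(hd w.1).eq_zero v.1 (fun heq => hw (Subtype.ext heq.symm)) (v.2.trans w.2.symm).le,
      mul_zero]

theorem layerMap_surjective (n j : ℕ) : Function.Surjective (layerMap n j) := by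
  intro y
  choose h hh using fun w => mem_rightMul.1 (y w).2
  obtain ⟨t, ht, hF⟩ := exists_mem_lengthFiltration_FAlg_eq h
  exact ⟨⟨t, ht⟩, DFinsupp.ext fun w => Subtype.ext ((hF w).trans (hh w).symm)⟩

/-- The isomorphism `Γ_j / Γ_{j+1} ≃ ⨁_{ℓ(w)=j} R_w · Δ_w` induced by the maps `F_w`. -/
def layerEquiv (n j : ℕ) : Gr (lengthFiltration n j) (lengthFiltration n (j + 1)) ≃ₗ[Env n]
    ⨁ w : {w : Perm (Fin n) // length w = j}, rightMul w.1 (Delta w.1) :=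
  (Submodule.quotEquivOfEq _ _ (ker_layerMap n j).symm).trans
    ((layerMap n j).quotKerEquivOfSurjective (layerMap_surjective n j))

theorem layerEquiv_mk_apply (m : lengthFiltration n j)
    (w : {w : Perm (Fin n) // length w = j}) :
    (layerEquiv n j (Submodule.Quotient.mk m) w : RTw w.1) = F w.1 (m : T n) :=
  layerMap_apply m w

end Filtration

end

end GammaFiltration

theorem mainTheorem8 (n : ℕ) :
    ∃ Γ : ℕ → Submodule (GammaFiltration.Env n) (GammaFiltration.T n),
      Γ 0 = ⊤ ∧
      Γ (n.choose 2 + 1) = ⊥ ∧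
      ∀ j ≤ n.choose 2,
        Γ (j + 1) ≤ Γ j ∧
        (∃ e : GammaFiltration.Gr (Γ j) (Γ (j + 1)) ≃ₗ[GammaFiltration.Env n]
            ⨁ w : {w : Equiv.Perm (Fin n) // GammaFiltration.length w = j},
              GammaFiltration.rightMul w.1 (GammaFiltration.Delta w.1),
          ∀ (m : Γ j) (w : {w : Equiv.Perm (Fin n) // GammaFiltration.length w = j}),
            ((e (Submodule.Quotient.mk m) w : GammaFiltration.rightMul w.1
              (GammaFiltration.Delta w.1)) : GammaFiltration.RTw w.1) =
              GammaFiltration.F w.1 (m : GammaFiltration.T n)) ∧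
        Nonempty (GammaFiltration.Gr (Γ j) (Γ (j + 1)) ≃ₗ[GammaFiltration.Env n]
            ⨁ w : {w : Equiv.Perm (Fin n) // GammaFiltration.length w = j},
              GammaFiltration.leftMul w.1 (GammaFiltration.Delta w.1)) := by
  open GammaFiltration in
  refine ⟨lengthFiltration n, lengthFiltration_zero n, lengthFiltration_choose_two_add_one n,
    fun j _ => ⟨lengthFiltration_antitone n j.le_succ, ?_, ?_⟩⟩
  · exact ⟨layerEquiv n j, layerEquiv_mk_apply⟩
  · exact ⟨(layerEquiv n j).trans
      (DFinsupp.mapRange.linearEquiv fun w => rightMulEquivLeftMul w.1)⟩
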